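/- Call a set $W\subseteq\mathbb{R}^n$ a (possibly unbounded) convex body if it is closed and convex and has nonempty interior. If moreover $0\in\operatorname{int}(W)$, call $W$ of class $C^1$ if its Minkowski functional $\mu_W(x)=\inf\{\lambda>0 : \tfrac1\lambda x\in W\}$ is of class $C^1$ on the open set $\mathbb{R}^n\setminus\mu_W^{-1}(0)$; in that case let $n_W(x)=\nabla\mu_W(x)/|\nabla\mu_W(x)|$, $x\in\partial W$, denote the outer normal to $\partial W$. Let $E$ be an arbitrary subset of $\mathbb{R}^n$, let $N:E\to\mathbb{S}^{n-1}$ be a continuous mapping, let $X=\operatorname{span}(N(E))$, and let $P:\mathbb{R}^n\to X$ be the orthogonal projection. Then there exists a (possibly unbounded) convex body $W$ of class $C^1$ such that $E\subseteq\partial W$, $0\in\operatorname{int}(W)$, $N(x)=n_W(x)$ for all $x\in E$, and $X=\operatorname{span}(n_W(\partial W))$, if and only if the following three conditions are satisfied: 1. $\langle N(y),x-y\rangle\le 0$ for all $x,y\in E$. 2. For all sequences $(x_k)_k$, $(z_k)_k$ contained in $E$ with $(P(x_k))_k$ bounded, we have $$\lim_{k\to\infty}\langle N(z_k),x_k-z_k\rangle=0\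 \Longrightarrow\ \lim_{k\to\infty}|N(z_k)-N(x_k)|=0.$$ 3. $0<\inf_{y\in E}\langle N(y),y\rangle$ (where $\inf\emptyset=+\infty$). -/

import Mathlib

noncomputable section

/-- A (possibly unbounded) convex body in `ℝⁿ`: a closed convex set with nonempty interior. -/
structure IsConvexBody {n : ℕ} (W : Set (EuclideanSpace ℝ (Fin n))) : Prop where
  isClosed : IsClosed W
  convex : Convex ℝ W
  nonempty_interior : (interior W).Nonempty

/-- A convex body `W` with `0 ∈ int W` is of class `C¹` if its Minkowski functional
`μ_W x = inf {r > 0 : x ∈ r • W}` (Mathlib's `gauge W`) is of class `C¹` on the set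
`ℝⁿ \ μ_W⁻¹(0)`, which is open because `0 ∈ int W`. -/
def IsOfClassC1 {n : ℕ} (W : Set (EuclideanSpace ℝ (Fin n))) : Prop :=
  ContDiffOn ℝ 1 (gauge W) (gauge W ⁻¹' {0})ᶜ

/-- The outer normal `n_W(x) = ∇μ_W(x) / |∇μ_W(x)|`, meant for `x ∈ ∂W`, where `W` is a
convex body of class `C¹` with `0 ∈ int W`. -/
def outerNormal {n : ℕ} (W : Set (EuclideanSpace ℝ (Fin n)))
    (x : EuclideanSpace ℝ (Fin n)) : EuclideanSpace ℝ (Fin n) :=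
  ‖gradient (gauge W) x‖⁻¹ • gradient (gauge W) x

end

/-! Sufficiency. The gauge of the polar of a compact `K ∋ 0` is the support function of `K`; where
positive it is `C¹` if positive maximizers on `K` are unique, the maximizer being the gradient
(`contDiffOn_gauge_innerPolar`). Prescribe the gradients `g x = N x / ⟪N x, x⟫`, bounded by
condition 3. It remains to find a compact `K ⊆ X` containing `0` and all `g x`, lying in every
half-space `⟪·, x⟫ ≤ 1`, `x ∈ E`, and having unique positive maximizers.

The convex hull of `0` and the `g x`, with support function `h`, may have flat faces. It is enlarged
to an intersection of balls, whose radii blow up only near the directions of the projected points of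
`E`. The midpoint of two maximizers is strictly inside every ball, so it can be blocked only by a
limiting half-space `⟪·, y⟫ ≤ h y`. At such `y` the support function of `K` exceeds `h` only to
second order, so maximizers are governed by near-maximizing `g z`, and condition 2 makes these agree
(`eq_of_inner_eq_posSupport`). This leaves only `y` with `h y = 0`, and there the midpoint can still
be pushed outwards (`exists_midpoint_add_smul_mem`), contradicting maximality.

Necessity. The gradient at a boundary point is the only linear functional below the gauge touching
it there, and gradients are bounded since the gauge is Lipschitz; this gives conditions 1 and 3. For
condition 2, the projections of the `x k` cluster at a boundary point `p`, and the gradients at both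
`z k` and `x k` can only cluster at the functional touching at `p`. -/

open Filter Topology Set
open scoped RealInnerProductSpace Gradient

/-! ### Polars of compact sets and differentiability of their gauges. -/

section PolarSet

variable {F : Type*} [NormedAddCommGroup F] [InnerProductSpace ℝ F]

/-- The (one-sided) polar set of `K`. -/
def innerPolar (K : Set F) : Set F := {x | ∀ k ∈ K, ⟪k, x⟫ ≤ 1}

lemma isClosed_innerPolar (K : Set F) : IsClosed (innerPolar K) := by
  simp only [innerPolar, ofPred_forall]
  exact isClosed_biInter fun k _ => isClosed_le (by fun_prop) continuous_const

lemma convex_innerPolar (K : Set F) : Convex ℝ (innerPolar K) := by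
  intro x hx y hy a b ha hb hab k hk
  rw [inner_add_right, inner_smul_right, inner_smul_right]
  nlinarith [hx k hk, hy k hk]

lemma innerPolar_mem_nhds_zero {K : Set F} (hK : Bornology.IsBounded K) :
    innerPolar K ∈ 𝓝 (0 : F) := by
  obtain ⟨M, hM0, hM⟩ := hK.exists_pos_norm_le
  refine Filter.mem_of_superset (Metric.closedBall_mem_nhds 0 (inv_pos.2 hM0)) fun x hx k hk => ?_
  rw [mem_closedBall_zero_iff] at hx
  calc ⟪k, x⟫ ≤ ‖k‖ * ‖x‖ := real_inner_le_norm _ _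
    _ ≤ M * M⁻¹ := by gcongr; exact hM k hk
    _ = 1 := mul_inv_cancel₀ hM0.ne'

lemma inner_le_gauge_innerPolar {K : Set F} (hK : Bornology.IsBounded K) {k : F} (hk : k ∈ K)
    (x : F) : ⟪k, x⟫ ≤ gauge (innerPolar K) x := by
  refine le_of_forall_gt fun r hr => ?_
  obtain ⟨b, hb0, hbr, y, hy, rfl⟩ := exists_lt_of_gauge_lt
    (absorbent_nhds_zero (innerPolar_mem_nhds_zero hK)) hr
  simp only [inner_smul_right]
  nlinarith [hy k hk]

lemma exists_inner_eq_gauge_innerPolar {K : Set F} (hK : IsCompact K) (h0 : (0 : F) ∈ K) (x : F) :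
    ∃ k ∈ K, ⟪k, x⟫ = gauge (innerPolar K) x := by
  obtain ⟨k, hk, hmax⟩ := hK.exists_isMaxOn (f := fun k => ⟪k, x⟫) ⟨0, h0⟩
    (by fun_prop)
  refine ⟨k, hk, le_antisymm (inner_le_gauge_innerPolar hK.isBounded hk x) ?_⟩
  refine le_of_forall_gt_imp_ge_of_dense fun r hr => ?_
  have hr0 : 0 < r := lt_of_le_of_lt (by simpa using hmax h0) hr
  refine gauge_le_of_mem hr0.le ?_
  rw [Set.mem_smul_set_iff_inv_smul_mem₀ hr0.ne']
  intro k' hk'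
  rw [inner_smul_right, inv_mul_le_one₀ hr0]
  exact (hmax hk').trans hr.le

/-- A continuous linear functional is maximized at one point of `K` only, as soon as its maximum
over `K` is positive. -/
def UniquePosMaximizers (K : Set F) : Prop :=
  ∀ x, ∀ k₁ ∈ K, ∀ k₂ ∈ K, (∀ k ∈ K, ⟪k, x⟫ ≤ ⟪k₁, x⟫) → ⟪k₁, x⟫ = ⟪k₂, x⟫ → 0 < ⟪k₁, x⟫ → k₁ = k₂

variable {K : Set F}

/-- By compactness it suffices to look at cluster points of `κ` at `x`. Such a point still attains
the gauge at `x`, because the gauge is continuous, so uniqueness identifies it with `k`. -/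
lemma tendsto_of_inner_eq_gauge (hK : IsCompact K) (hu : UniquePosMaximizers K)
    {κ : F → F} (hκ : ∀ x, κ x ∈ K ∧ ⟪κ x, x⟫ = gauge (innerPolar K) x)
    {x k : F} (hk : k ∈ K) (hkx : ⟪k, x⟫ = gauge (innerPolar K) x)
    (hx : 0 < gauge (innerPolar K) x) : Tendsto κ (𝓝 x) (𝓝 k) := by
  have hW := innerPolar_mem_nhds_zero hK.isBounded
  have hc := continuous_gauge (convex_innerPolar K) hW
  refine hK.tendsto_nhds_of_unique_mapClusterPt (Eventually.of_forall fun x => (hκ x).1) ?_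
  intro q hq hcl
  have h1 : MapClusterPt (⟪q, x⟫) (𝓝 x) fun x' => ⟪κ x', x⟫ :=
    hcl.tendsto_comp (Continuous.tendsto (f := fun q => ⟪q, x⟫) (by fun_prop) q)
  obtain ⟨M, hM0, hM⟩ := hK.isBounded.exists_pos_norm_le
  have h2 : Tendsto (fun x' => ⟪κ x', x⟫) (𝓝 x) (𝓝 (gauge (innerPolar K) x)) := by
    have h3 : Tendsto (fun x' => ⟪κ x', x - x'⟫) (𝓝 x) (𝓝 0) := by
      refine squeeze_zero_norm (a := fun x' => M * ‖x - x'‖) (fun x' => ?_) ?_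
      · exact (norm_inner_le_norm _ _).trans (by gcongr; exact hM _ (hκ x').1)
      · exact (Continuous.tendsto' (by fun_prop) _ _ (by simp))
    have h4 := h3.add (hc.tendsto x)
    rw [zero_add] at h4
    refine h4.congr fun x' => ?_
    rw [← (hκ x').2, ← inner_add_right, sub_add_cancel]
  have h5 : ⟪q, x⟫ = gauge (innerPolar K) x := eq_of_nhds_neBot (h1.clusterPt.mono h2)
  exact hu x q hq k hk (fun k' hk' => h5 ▸ inner_le_gauge_innerPolar hK.isBounded hk' x)
    (h5.trans hkx.symm) (h5 ▸ hx)

lemma hasGradientAt_gauge_innerPolar [CompleteSpace F] (hK : IsCompact K) (h0 : (0 : F) ∈ K)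
    (hu : UniquePosMaximizers K) {x k : F} (hk : k ∈ K) (hkx : ⟪k, x⟫ = gauge (innerPolar K) x)
    (hx : 0 < gauge (innerPolar K) x) : HasGradientAt (gauge (innerPolar K)) k x := by
  choose κ hκ using fun x => exists_inner_eq_gauge_innerPolar hK h0 x
  have ht := tendsto_of_inner_eq_gauge hK hu hκ hk hkx hx
  rw [hasGradientAt_iff_isLittleO, Asymptotics.isLittleO_iff]
  intro c hc
  filter_upwards [Metric.tendsto_nhds.1 ht c hc] with x' hx'
  rw [dist_eq_norm] at hx'
  have h1 := inner_le_gauge_innerPolar hK.isBounded hk x'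
  have h2 := inner_le_gauge_innerPolar hK.isBounded (hκ x').1 x
  -- The remainder of the first-order expansion lies between `0` and this inner product.
  have h3 : ⟪κ x' - k, x' - x⟫ ≤ c * ‖x' - x‖ :=
    (real_inner_le_norm _ _).trans (by gcongr)
  simp only [inner_sub_left, inner_sub_right, (hκ x').2] at h3 ⊢
  rw [Real.norm_eq_abs, abs_of_nonneg (by linarith)]
  linarith

lemma contDiffOn_gauge_innerPolar [CompleteSpace F] (hK : IsCompact K) (h0 : (0 : F) ∈ K)
    (hu : UniquePosMaximizers K) :
    ContDiffOn ℝ 1 (gauge (innerPolar K)) (gauge (innerPolar K) ⁻¹' {0})ᶜ := by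
  choose κ hκ using fun x => exists_inner_eq_gauge_innerPolar hK h0 x
  have hc := continuous_gauge (convex_innerPolar K) (innerPolar_mem_nhds_zero hK.isBounded)
  have hopen : IsOpen (gauge (innerPolar K) ⁻¹' {0})ᶜ :=
    (isClosed_singleton.preimage hc).isOpen_compl
  have hpos : ∀ x ∈ (gauge (innerPolar K) ⁻¹' {0})ᶜ, 0 < gauge (innerPolar K) x :=
    fun x hx => lt_of_le_of_ne (gauge_nonneg x) (Ne.symm hx)
  have hg : ∀ x ∈ (gauge (innerPolar K) ⁻¹' {0})ᶜ, HasGradientAt (gauge (innerPolar K)) (κ x) x :=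
    fun x hx => hasGradientAt_gauge_innerPolar hK h0 hu (hκ x).1 (hκ x).2 (hpos x hx)
  rw [← zero_add (1 : WithTop ℕ∞), contDiffOn_succ_iff_fderiv_of_isOpen hopen]
  refine ⟨fun x hx => (hg x hx).differentiableAt.differentiableWithinAt, by simp, ?_⟩
  rw [contDiffOn_zero]
  have hκc : ContinuousOn κ (gauge (innerPolar K) ⁻¹' {0})ᶜ := fun x hx =>
    (tendsto_of_inner_eq_gauge hK hu hκ (hκ x).1 (hκ x).2 (hpos x hx)).mono_left
      nhdsWithin_le_nhds
  refine ((InnerProductSpace.toDual ℝ F).continuous.comp_continuousOn hκc).congr fun x hx => ?_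
  exact (hasGradientAt_iff_hasFDerivAt.1 (hg x hx)).fderiv

end PolarSet

/-! ### The intersection of balls and its support function. -/

section BallIntersection

variable {V : Type*} [NormedAddCommGroup V] [InnerProductSpace ℝ V] {ι : Type*}

/-- Points `a i` on the boundary of a convex set, together with the vectors `g i` which are to be
the gradients of its gauge at these points. -/
structure IsContactFamily (g a : ι → V) (L : ℝ) : Prop where
  pos : 0 < L
  norm_le : ∀ i, ‖g i‖ ≤ L
  inner_le_one : ∀ i j, ⟪g i, a j⟫ ≤ 1
  inner_self : ∀ i, ⟪g i, a i⟫ = 1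
  stable : ∀ i j : ℕ → ι, Bornology.IsBounded (range fun m => a (i m)) →
    Tendsto (fun m => ⟪g (j m), a (i m)⟫) atTop (𝓝 1) →
    Tendsto (fun m => g (j m) - g (i m)) atTop (𝓝 0)
  span_eq_top : Submodule.span ℝ (range g) = ⊤

/-- The support function of the convex hull of the `g i` and `0`. -/
noncomputable def posSupport (g : ι → V) (x : V) : ℝ := ⨆ i, max 0 ⟪g i, x⟫

/-- The directions of the vectors `a i`. -/
noncomputable def unitDirections (a : ι → V) : Set V := range fun i => ‖a i‖⁻¹ • a i

/-- An intersection of balls containing all the `g i`; the balls become large, and tend to the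
half-spaces `⟪k, y⟫ ≤ posSupport g y`, as `y` approaches the directions of the `a i`. -/
noncomputable def ballIntersection (g a : ι → V) (L : ℝ) : Set V :=
  {k | ∀ y : V, ‖y‖ = 1 → ∀ δ : ℝ, 0 < δ → δ ≤ 4 →
    Metric.infDist y (unitDirections a) ^ 2 ≤ δ →
    ‖k + (L ^ 2 / (2 * δ)) • y‖ ≤ posSupport g y + δ + L ^ 2 / (2 * δ)}

variable {g a : ι → V} {L : ℝ}

lemma posSupport_nonneg (x : V) : 0 ≤ posSupport g x :=
  Real.iSup_nonneg fun _ => le_max_left _ _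

namespace IsContactFamily

lemma posSupport_bddAbove (H : IsContactFamily g a L) (x : V) :
    BddAbove (range fun i => max 0 ⟪g i, x⟫) := by
  refine ⟨L * ‖x‖, ?_⟩
  rintro _ ⟨i, rfl⟩
  refine max_le (mul_nonneg H.pos.le (norm_nonneg _)) ((real_inner_le_norm _ _).trans ?_)
  gcongr
  exact H.norm_le i

lemma inner_le_posSupport (H : IsContactFamily g a L) (i : ι) (x : V) :
    ⟪g i, x⟫ ≤ posSupport g x :=
  (le_max_right _ _).trans (le_ciSup (H.posSupport_bddAbove x) i)

lemma posSupport_le_add [Nonempty ι] (H : IsContactFamily g a L) (x y : V) :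
    posSupport g x ≤ posSupport g y + L * dist x y := by
  have hLd : 0 ≤ L * dist x y := mul_nonneg H.pos.le dist_nonneg
  refine ciSup_le fun i => max_le (add_nonneg (posSupport_nonneg _) hLd) ?_
  have h1 : ⟪g i, x - y⟫ ≤ L * dist x y := by
    rw [dist_eq_norm]
    exact (real_inner_le_norm _ _).trans (by gcongr; exact H.norm_le i)
  rw [inner_sub_right] at h1
  linarith [H.inner_le_posSupport i y]

lemma continuous_posSupport [Nonempty ι] (H : IsContactFamily g a L) :
    Continuous (posSupport g) :=
  (LipschitzWith.of_le_add_mul ⟨L, H.pos.le⟩ H.posSupport_le_add).continuous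

lemma posSupport_smul {r : ℝ} (hr : 0 ≤ r) (x : V) :
    posSupport g (r • x) = r * posSupport g x := by
  simp only [posSupport, Real.mul_iSup_of_nonneg hr, inner_smul_right, mul_max_of_nonneg _ _ hr,
    mul_zero]

lemma posSupport_point [Nonempty ι] (H : IsContactFamily g a L) (i : ι) :
    posSupport g (a i) = 1 :=
  le_antisymm (ciSup_le fun j => max_le zero_le_one (H.inner_le_one j i))
    ((H.inner_self i).symm.le.trans (H.inner_le_posSupport i _))

lemma point_ne_zero (H : IsContactFamily g a L) (i : ι) : a i ≠ 0 := by
  intro h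
  simpa [h] using H.inner_self i

lemma norm_point_pos (H : IsContactFamily g a L) (i : ι) : 0 < ‖a i‖ :=
  norm_pos_iff.2 (H.point_ne_zero i)

lemma posSupport_direction [Nonempty ι] (H : IsContactFamily g a L) (i : ι) :
    posSupport g (‖a i‖⁻¹ • a i) = ‖a i‖⁻¹ := by
  rw [posSupport_smul (by positivity), H.posSupport_point, mul_one]

lemma norm_direction (H : IsContactFamily g a L) (i : ι) : ‖‖a i‖⁻¹ • a i‖ = 1 := by
  rw [norm_smul, norm_inv, norm_norm, inv_mul_cancel₀ (H.norm_point_pos i).ne']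

lemma infDist_le_two [Nonempty ι] (H : IsContactFamily g a L) {y : V} (hy : ‖y‖ = 1) :
    Metric.infDist y (unitDirections a) ≤ 2 := by
  obtain ⟨i⟩ := ‹Nonempty ι›
  refine (Metric.infDist_le_dist_of_mem (mem_range_self i)).trans ?_
  rw [dist_eq_norm]
  exact (norm_sub_le _ _).trans (by rw [hy, H.norm_direction]; norm_num)

lemma mem_ballIntersection (H : IsContactFamily g a L) {k : V} (hk : ‖k‖ ≤ L)
    (hk' : ∀ y, ⟪k, y⟫ ≤ posSupport g y) : k ∈ ballIntersection g a L := by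
  intro y hy δ hδ _ _
  have hL := H.pos
  set ρ := L ^ 2 / (2 * δ) with hρ
  have hρ0 : 0 < ρ := by positivity
  -- This is why `ρ` has its value: `‖k + ρ y‖² ≤ L² + 2ρh + ρ² = 2ρ(h + δ) + ρ² ≤ (h + δ + ρ)²`,
  -- with `h = posSupport g y`.
  have h2 : 2 * ρ * δ = L ^ 2 := by rw [hρ]; field_simp
  have h0 := posSupport_nonneg (g := g) y
  refine le_of_sq_le_sq ?_ (by positivity)
  rw [norm_add_sq_real, inner_smul_right, norm_smul, hy, Real.norm_of_nonneg hρ0.le]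
  nlinarith [hk' y, norm_nonneg k, mul_le_mul_of_nonneg_left (hk' y) hρ0.le]

lemma gradient_mem (H : IsContactFamily g a L) (i : ι) : g i ∈ ballIntersection g a L :=
  H.mem_ballIntersection (H.norm_le i) (H.inner_le_posSupport i)

lemma zero_mem (H : IsContactFamily g a L) : (0 : V) ∈ ballIntersection g a L :=
  H.mem_ballIntersection (by simpa using H.pos.le) fun y => by simpa using posSupport_nonneg y

lemma isClosed_ballIntersection : IsClosed (ballIntersection g a L) := by
  simp only [ballIntersection, ofPred_forall]
  refine isClosed_iInter fun y => isClosed_iInter fun _ => isClosed_iInter fun δ =>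
    isClosed_iInter fun _ => isClosed_iInter fun _ => isClosed_iInter fun _ => ?_
  exact isClosed_le (by fun_prop) continuous_const

lemma isBounded_ballIntersection [Nonempty ι] (H : IsContactFamily g a L) :
    Bornology.IsBounded (ballIntersection g a L) := by
  obtain ⟨i⟩ := ‹Nonempty ι›
  have : Nonempty ι := ⟨i⟩
  refine isBounded_iff_forall_norm_le.2 ⟨posSupport g (‖a i‖⁻¹ • a i) + 4 + L ^ 2 / (2 * 4) +
    L ^ 2 / (2 * 4), fun k hk => ?_⟩
  -- A single ball suffices; `δ = 4` is always admissible, since unit vectors are at distance at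
  -- most `2`.
  have h := hk _ (H.norm_direction i) 4 (by norm_num) le_rfl
    (by nlinarith [H.infDist_le_two (H.norm_direction i),
      Metric.infDist_nonneg (x := ‖a i‖⁻¹ • a i) (s := unitDirections a)])
  have h2 := norm_le_norm_add_norm_sub' k (k + (L ^ 2 / (2 * 4)) • (‖a i‖⁻¹ • a i))
  have h3 : ‖k - (k + (L ^ 2 / (2 * 4)) • (‖a i‖⁻¹ • a i))‖ = L ^ 2 / (2 * 4) := by
    rw [sub_add_cancel_left, norm_neg, norm_smul, H.norm_direction, mul_one,
      Real.norm_of_nonneg (by positivity)]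
  linarith

lemma isCompact_ballIntersection [FiniteDimensional ℝ V] [Nonempty ι]
    (H : IsContactFamily g a L) : IsCompact (ballIntersection g a L) :=
  have := FiniteDimensional.proper ℝ V
  Metric.isCompact_of_isClosed_isBounded isClosed_ballIntersection H.isBounded_ballIntersection

/-- Each ball lies in its supporting half-space `⟪k, y⟫ ≤ posSupport g y + δ`. The best `δ` is the
squared distance, or the limit `δ → 0` when that vanishes. -/
lemma inner_le_of_mem [Nonempty ι] (H : IsContactFamily g a L) {k : V}
    (hk : k ∈ ballIntersection g a L) {y : V} (hy : ‖y‖ = 1) :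
    ⟪k, y⟫ ≤ posSupport g y + Metric.infDist y (unitDirections a) ^ 2 := by
  have key : ∀ δ, 0 < δ → δ ≤ 4 → Metric.infDist y (unitDirections a) ^ 2 ≤ δ →
      ⟪k, y⟫ ≤ posSupport g y + δ := fun δ h0 h4 hδ => by
    have h1 := hk y hy δ h0 h4 hδ
    have h2 := real_inner_le_norm (k + (L ^ 2 / (2 * δ)) • y) y
    rw [inner_add_left, inner_smul_left, real_inner_self_eq_norm_sq, hy] at h2
    simp at h2
    linarith
  have h4 : Metric.infDist y (unitDirections a) ^ 2 ≤ 4 := by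
    nlinarith [H.infDist_le_two hy, Metric.infDist_nonneg (x := y) (s := unitDirections a)]
  rcases (sq_nonneg (Metric.infDist y (unitDirections a))).eq_or_lt with h | h
  · rw [← h, add_zero]
    refine le_of_forall_pos_le_add fun ε hε => ?_
    exact (key (min ε 4) (by positivity) (min_le_right _ _) (h ▸ by positivity)).trans
      (by gcongr; exact min_le_left _ _)
  · exact key _ h h4 le_rfl

lemma inner_le_of_mem_closure [Nonempty ι] (H : IsContactFamily g a L) {k : V}
    (hk : k ∈ ballIntersection g a L) {y : V} (hy : ‖y‖ = 1)
    (hyB : y ∈ closure (unitDirections a)) : ⟪k, y⟫ ≤ posSupport g y := by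
  simpa [Metric.infDist_zero_of_mem_closure hyB] using H.inner_le_of_mem hk hy

lemma inner_point_le_one [Nonempty ι] (H : IsContactFamily g a L) {k : V}
    (hk : k ∈ ballIntersection g a L) (i : ι) : ⟪k, a i⟫ ≤ 1 := by
  have h := H.inner_le_of_mem_closure hk (H.norm_direction i) (subset_closure (mem_range_self i))
  have := H.norm_point_pos i
  rw [H.posSupport_direction, inner_smul_right] at h
  exact (mul_le_iff_le_one_right (inv_pos.2 this)).1 h

end IsContactFamily

end BallIntersection

/-! ### Uniqueness of contact points in limiting directions. -/

section UniqueMaximizer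

variable {V : Type*} [NormedAddCommGroup V] [InnerProductSpace ℝ V] {ι : Type*}
  {g a : ι → V} {L : ℝ}

lemma norm_inv_norm_smul_sub_le {x y : V} (hy : ‖y‖ = 1) (hx : x ≠ 0) :
    ‖‖x‖⁻¹ • x - y‖ ≤ 2 * ‖x - y‖ := by
  have hx' : 0 < ‖x‖ := norm_pos_iff.2 hx
  have h1 : ‖‖x‖⁻¹ • x - x‖ = |1 - ‖x‖| := by
    have : ‖x‖⁻¹ • x - x = (‖x‖⁻¹ * (1 - ‖x‖)) • x := by
      rw [mul_sub, mul_one, inv_mul_cancel₀ hx'.ne', sub_smul, one_smul]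
    rw [this, norm_smul, norm_mul, norm_inv, norm_norm, Real.norm_eq_abs]
    field_simp
  have h2 : |1 - ‖x‖| ≤ ‖x - y‖ := by
    rw [← hy, norm_sub_rev x y]
    exact abs_norm_sub_norm_le y x
  calc ‖‖x‖⁻¹ • x - y‖ ≤ ‖‖x‖⁻¹ • x - x‖ + ‖x - y‖ := norm_sub_le_norm_sub_add_norm_sub _ _ _
    _ ≤ 2 * ‖x - y‖ := by linarith

namespace IsContactFamily

/-- The error is quadratic in `‖x - y‖`, so along `x = y + t v` it survives division by `t`. -/
lemma inner_le_near_closure [Nonempty ι] (H : IsContactFamily g a L) {k : V} (hk : k ∈ ballIntersection g a L)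
    {y : V} (hy : ‖y‖ = 1) (hyB : y ∈ closure (unitDirections a)) (x : V) :
    ⟪k, x⟫ ≤ posSupport g x + 4 * ‖x‖ * ‖x - y‖ ^ 2 := by
  rcases eq_or_ne x 0 with rfl | hx
  · simpa using posSupport_nonneg (g := g) 0
  have hx' : 0 < ‖x‖ := norm_pos_iff.2 hx
  have h1 := H.inner_le_of_mem hk (y := ‖x‖⁻¹ • x)
    (by rw [norm_smul, norm_inv, norm_norm, inv_mul_cancel₀ hx'.ne'])
  have h2 : Metric.infDist (‖x‖⁻¹ • x) (unitDirections a) ≤ 2 * ‖x - y‖ := by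
    rw [← Metric.infDist_closure]
    refine (Metric.infDist_le_dist_of_mem hyB).trans ?_
    rw [dist_eq_norm]
    exact norm_inv_norm_smul_sub_le hy hx
  have h3 : Metric.infDist (‖x‖⁻¹ • x) (unitDirections a) ^ 2 ≤ (2 * ‖x - y‖) ^ 2 := by
    gcongr
    exact Metric.infDist_nonneg
  rw [posSupport_smul (by positivity), inner_smul_right] at h1
  have h4 : ‖x‖⁻¹ * ⟪k, x⟫ ≤ ‖x‖⁻¹ * (posSupport g x + 4 * ‖x‖ * ‖x - y‖ ^ 2) := by
    refine (h1.trans (add_le_add_right h3 _)).trans_eq ?_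
    field_simp
    ring
  exact le_of_mul_le_mul_left h4 (inv_pos.2 hx')

lemma exists_approximating_gradients [Nonempty ι] (H : IsContactFamily g a L) {k : V}
    (hk : k ∈ ballIntersection g a L) {y : V} (hy : ‖y‖ = 1)
    (hyB : y ∈ closure (unitDirections a)) (hpos : 0 < posSupport g y)
    (hky : ⟪k, y⟫ = posSupport g y) (v : V) :
    ∃ z : ℕ → ι, Tendsto (fun m => ⟪g (z m), y⟫) atTop (𝓝 (posSupport g y)) ∧
      ∃ e : ℕ → ℝ, Tendsto e atTop (𝓝 0) ∧ ∀ᶠ m in atTop, ⟪k, v⟫ ≤ ⟪g (z m), v⟫ + e m := by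
  set t : ℕ → ℝ := fun m => 1 / ((m : ℝ) + 1) with ht
  have ht0 : ∀ m, 0 < t m := fun m => Nat.one_div_pos_of_nat
  have htlim : Tendsto t atTop (𝓝 0) := tendsto_one_div_add_atTop_nhds_zero_nat
  set x : ℕ → V := fun m => y + t m • v with hx
  have hxlim : Tendsto x atTop (𝓝 y) := by
    simpa using (htlim.smul_const v).const_add y
  have hhx : Tendsto (fun m => posSupport g (x m)) atTop (𝓝 (posSupport g y)) :=
    (H.continuous_posSupport.tendsto y).comp hxlim
  -- Accuracy `t ^ 2` is needed because the estimate is later divided by `t`.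
  have hz : ∀ m, ∃ i, posSupport g (x m) - t m ^ 2 < max 0 ⟪g i, x m⟫ := fun m =>
    exists_lt_of_lt_ciSup (sub_lt_self _ (pow_pos (ht0 m) 2))
  choose z hz using hz
  have hev : ∀ᶠ m in atTop, posSupport g (x m) - t m ^ 2 < ⟪g (z m), x m⟫ := by
    have h1 : Tendsto (fun m => posSupport g (x m) - t m ^ 2) atTop (𝓝 (posSupport g y)) := by
      simpa using hhx.sub (htlim.pow 2)
    filter_upwards [h1.eventually_const_lt hpos] with m hm
    exact ((lt_max_iff.1 (hz m)).resolve_left hm.not_gt)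
  have hgv : ∀ m, ⟪g (z m), v⟫ ≤ L * ‖v‖ := fun m =>
    (real_inner_le_norm _ _).trans (by gcongr; exact H.norm_le _)
  have hgx : ∀ m, ⟪g (z m), x m⟫ = ⟪g (z m), y⟫ + t m * ⟪g (z m), v⟫ := fun m => by
    rw [hx, inner_add_right, inner_smul_right]
  refine ⟨z, ?_, fun m => t m * (1 + 4 * ‖x m‖ * ‖v‖ ^ 2), ?_, ?_⟩
  · have h2 : Tendsto (fun m => posSupport g (x m) - t m ^ 2 - t m * (L * ‖v‖)) atTop
        (𝓝 (posSupport g y)) := by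
      simpa using (hhx.sub (htlim.pow 2)).sub (htlim.mul_const (L * ‖v‖))
    refine tendsto_of_tendsto_of_tendsto_of_le_of_le' h2 tendsto_const_nhds ?_
      (Eventually.of_forall fun m => H.inner_le_posSupport _ _)
    filter_upwards [hev] with m hm
    nlinarith [hgx m, hgv m, ht0 m]
  · simpa using htlim.mul (((hxlim.norm.const_mul 4).mul_const (‖v‖ ^ 2)).const_add 1)
  · filter_upwards [hev] with m hm
    have h3 := H.inner_le_near_closure hk hy hyB (x m)
    have h4 : ⟪k, x m⟫ = posSupport g y + t m * ⟪k, v⟫ := by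
      rw [hx, inner_add_right, inner_smul_right, hky]
    have h5 : ‖x m - y‖ = t m * ‖v‖ := by
      rw [hx, add_sub_cancel_left, norm_smul, Real.norm_of_nonneg (ht0 m).le]
    rw [h5] at h3
    have h6 := H.inner_le_posSupport (z m) y
    refine le_of_mul_le_mul_left ?_ (ht0 m)
    nlinarith [hgx m]

/-- Approximating gradients for `k₁` and `k₂` in the opposite directions `±(k₁ - k₂)` bound `‖k₁ -
k₂‖²` by a quantity that tends to `0`: by `stable`, both sequences approach the gradients at points
`a (i m)` whose directions tend to `y`. -/
lemma eq_of_inner_eq_posSupport [Nonempty ι] (H : IsContactFamily g a L) {y : V} (hy : ‖y‖ = 1)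
    (hyB : y ∈ closure (unitDirections a)) (hpos : 0 < posSupport g y) {k₁ k₂ : V}
    (hk₁ : k₁ ∈ ballIntersection g a L) (hk₂ : k₂ ∈ ballIntersection g a L)
    (h₁ : ⟪k₁, y⟫ = posSupport g y) (h₂ : ⟪k₂, y⟫ = posSupport g y) : k₁ = k₂ := by
  obtain ⟨b, hb, hblim⟩ := mem_closure_iff_seq_limit.1 hyB
  choose i hi using hb
  have hnorm : Tendsto (fun m => ‖a (i m)‖) atTop (𝓝 (posSupport g y)⁻¹) := by
    have := ((H.continuous_posSupport.tendsto y).comp hblim).inv₀ hpos.ne'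
    refine this.congr fun m => ?_
    simp [← hi m, H.posSupport_direction]
  have halim : Tendsto (fun m => a (i m)) atTop (𝓝 ((posSupport g y)⁻¹ • y)) := by
    refine (hnorm.smul hblim).congr fun m => ?_
    rw [← hi m, smul_smul, mul_inv_cancel₀ (H.norm_point_pos _).ne', one_smul]
  have hab : Bornology.IsBounded (range fun m => a (i m)) := Metric.isBounded_range_of_tendsto _ halim
  have key : ∀ z : ℕ → ι, Tendsto (fun m => ⟪g (z m), y⟫) atTop (𝓝 (posSupport g y)) →
      Tendsto (fun m => g (z m) - g (i m)) atTop (𝓝 0) := by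
    intro z hz
    refine H.stable i z hab ?_
    have e1 : Tendsto (fun m => ⟪g (z m), a (i m) - (posSupport g y)⁻¹ • y⟫) atTop (𝓝 0) := by
      refine squeeze_zero_norm (a := fun m => L * ‖a (i m) - (posSupport g y)⁻¹ • y‖)
        (fun m => (norm_inner_le_norm _ _).trans (by gcongr; exact H.norm_le _)) ?_
      simpa using (tendsto_iff_norm_sub_tendsto_zero.1 halim).const_mul L
    have e2 := e1.add (hz.const_mul (posSupport g y)⁻¹)
    rw [zero_add, inv_mul_cancel₀ hpos.ne'] at e2
    refine e2.congr fun m => ?_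
    rw [← inner_smul_right (𝕜 := ℝ), ← inner_add_right, sub_add_cancel]
  obtain ⟨z, hz, e, he, hze⟩ := H.exists_approximating_gradients hk₁ hy hyB hpos h₁ (k₁ - k₂)
  obtain ⟨z', hz', e', he', hze'⟩ := H.exists_approximating_gradients hk₂ hy hyB hpos h₂ (-(k₁ - k₂))
  have hlim : Tendsto (fun m => ⟪g (z m) - g (z' m), k₁ - k₂⟫ + (e m + e' m)) atTop (𝓝 0) := by
    have h3 := (key z hz).sub (key z' hz')
    simp only [sub_sub_sub_cancel_right, sub_zero] at h3
    simpa using (h3.inner (𝕜 := ℝ) tendsto_const_nhds (y := k₁ - k₂)).add (he.add he')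
  have hle : ⟪k₁ - k₂, k₁ - k₂⟫ ≤ 0 := by
    refine ge_of_tendsto hlim ?_
    filter_upwards [hze, hze'] with m h3 h4
    rw [inner_neg_right, inner_neg_right] at h4
    rw [inner_sub_left, inner_sub_left]
    linarith
  exact sub_eq_zero.1 (real_inner_self_nonpos.1 hle)

end IsContactFamily

end UniqueMaximizer

/-! ### Pushing the midpoint outwards, and uniqueness of positive maximizers. -/

section Perturbation

variable {V : Type*} [NormedAddCommGroup V] [InnerProductSpace ℝ V] {ι : Type*}
  {g a : ι → V} {L : ℝ}

namespace IsContactFamily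

/-- Take for `p` the sum of a basis chosen among the `g i`: every term is nonpositive on `y`, and
they cannot all vanish because the `g i` span. -/
lemma exists_inner_neg_of_posSupport_eq_zero [FiniteDimensional ℝ V] (H : IsContactFamily g a L) :
    ∃ p : V, ∀ y : V, y ≠ 0 → posSupport g y = 0 → ⟪p, y⟫ < 0 := by
  obtain ⟨b, hb, hspan, hli⟩ := exists_linearIndependent ℝ (range g)
  have hfin : b.Finite := hli.setFinite
  refine ⟨∑ v ∈ hfin.toFinset, v, fun y hy hy0 => ?_⟩
  have hle : ∀ v ∈ b, ⟪v, y⟫ ≤ 0 := fun v hv => by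
    obtain ⟨i, rfl⟩ := hb hv
    exact hy0 ▸ H.inner_le_posSupport i y
  rw [sum_inner]
  refine Finset.sum_neg' (fun v hv => hle v (hfin.mem_toFinset.1 hv)) ?_
  by_contra! hcon
  have hzero : ∀ v ∈ b, ⟪v, y⟫ = 0 := fun v hv =>
    le_antisymm (hle v hv) (hcon v (hfin.mem_toFinset.2 hv))
  have hall : ∀ v ∈ Submodule.span ℝ b, ⟪v, y⟫ = 0 := fun v hv => by
    induction hv using Submodule.span_induction with
    | mem v hv => exact hzero v hv
    | zero => exact inner_zero_left _
    | add u v _ _ hu hv => rw [inner_add_left, hu, hv, add_zero]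
    | smul c v _ hv => rw [inner_smul_left, hv, mul_zero]
  rw [hspan, H.span_eq_top] at hall
  exact hy (inner_self_eq_zero.1 (hall y Submodule.mem_top))

lemma norm_midpoint_add_lt {k₁ k₂ : V} (hne : k₁ ≠ k₂) (hk₁ : k₁ ∈ ballIntersection g a L)
    (hk₂ : k₂ ∈ ballIntersection g a L) {y : V} (hy : ‖y‖ = 1) {δ : ℝ} (hδ : 0 < δ) (hδ4 : δ ≤ 4)
    (hyδ : Metric.infDist y (unitDirections a) ^ 2 ≤ δ) :
    ‖(1 / 2 : ℝ) • k₁ + (1 / 2 : ℝ) • k₂ + (L ^ 2 / (2 * δ)) • y‖ <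
      posSupport g y + δ + L ^ 2 / (2 * δ) := by
  have h := norm_combo_lt_of_ne (hk₁ y hy δ hδ hδ4 hyδ) (hk₂ y hy δ hδ hδ4 hyδ)
    (fun h => hne (add_right_cancel h)) (by norm_num : (0 : ℝ) < 1 / 2)
    (by norm_num : (0 : ℝ) < 1 / 2) (by norm_num)
  convert h using 2
  module

/-- If every `t = 1/(m+1)` failed, the violated constraints `(y, δ)` would accumulate. A limit with
`δ > 0` is excluded by strict convexity of the ball, one with `δ = 0` by `hw`. -/
lemma exists_midpoint_add_smul_mem [FiniteDimensional ℝ V] [Nonempty ι]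
    (H : IsContactFamily g a L) {k₁ k₂ w : V} (hne : k₁ ≠ k₂)
    (hk₁ : k₁ ∈ ballIntersection g a L) (hk₂ : k₂ ∈ ballIntersection g a L)
    (hw : ∀ y : V, ‖y‖ = 1 → y ∈ closure (unitDirections a) → ⟪k₁, y⟫ = posSupport g y →
      ⟪k₂, y⟫ = posSupport g y → ⟪w, y⟫ < 0) :
    ∃ t : ℝ, 0 < t ∧ (1 / 2 : ℝ) • k₁ + (1 / 2 : ℝ) • k₂ + t • w ∈ ballIntersection g a L := by
  have := FiniteDimensional.proper ℝ V
  set k : V := (1 / 2 : ℝ) • k₁ + (1 / 2 : ℝ) • k₂ with hk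
  by_contra! hcon
  have hex : ∀ m : ℕ, ∃ y : V, ‖y‖ = 1 ∧ ∃ δ : ℝ, 0 < δ ∧ δ ≤ 4 ∧
      Metric.infDist y (unitDirections a) ^ 2 ≤ δ ∧ posSupport g y + δ + L ^ 2 / (2 * δ) <
        ‖k + (1 / ((m : ℝ) + 1)) • w + (L ^ 2 / (2 * δ)) • y‖ := fun m => by
    have := hcon (1 / ((m : ℝ) + 1)) Nat.one_div_pos_of_nat
    simp only [ballIntersection, mem_ofPred_eq] at this
    push Not at this
    obtain ⟨y, hy, δ, h1, h2, h3, h4⟩ := this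
    exact ⟨y, hy, δ, h1, h2, h3, h4⟩
  choose y' hy' δ' hδ' hδ4' hyδ' hbig' using hex
  obtain ⟨⟨y, δ⟩, hmem, φ, hφ, hlim⟩ :=
    ((isCompact_sphere (0 : V) 1).prod (isCompact_Icc (a := (0 : ℝ)) (b := 4))).tendsto_subseq
      (x := fun m => (y' m, δ' m))
      (fun m => ⟨mem_sphere_zero_iff_norm.2 (hy' m), (hδ' m).le, hδ4' m⟩)
  obtain ⟨hy1, hδ0, hδ4⟩ : ‖y‖ = 1 ∧ 0 ≤ δ ∧ δ ≤ 4 :=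
    ⟨mem_sphere_zero_iff_norm.1 hmem.1, hmem.2.1, hmem.2.2⟩
  set t : ℕ → ℝ := fun m => 1 / ((φ m : ℝ) + 1) with ht
  have ht0 : ∀ m, 0 < t m := fun m => Nat.one_div_pos_of_nat
  have htlim : Tendsto t atTop (𝓝 0) :=
    tendsto_one_div_add_atTop_nhds_zero_nat.comp hφ.tendsto_atTop
  have hylim : Tendsto (fun m => y' (φ m)) atTop (𝓝 y) := (continuous_fst.tendsto _).comp hlim
  have hδlim : Tendsto (fun m => δ' (φ m)) atTop (𝓝 δ) := (continuous_snd.tendsto _).comp hlim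
  have hhlim : Tendsto (fun m => posSupport g (y' (φ m))) atTop (𝓝 (posSupport g y)) :=
    (H.continuous_posSupport.tendsto y).comp hylim
  have hyδ : Metric.infDist y (unitDirections a) ^ 2 ≤ δ :=
    le_of_tendsto_of_tendsto' ((((Metric.continuous_infDist_pt _).tendsto y).comp hylim).pow 2)
      hδlim fun m => hyδ' (φ m)
  have hklim : Tendsto (fun m => k + t m • w) atTop (𝓝 k) := by
    simpa using (htlim.smul_const w).const_add k
  have hbig : ∀ m, posSupport g (y' (φ m)) + δ' (φ m) + L ^ 2 / (2 * δ' (φ m)) <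
      ‖k + t m • w + (L ^ 2 / (2 * δ' (φ m))) • y' (φ m)‖ := fun m => hbig' (φ m)
  rcases hδ0.eq_or_lt with rfl | hδpos
  · have hyB : y ∈ closure (unitDirections a) := by
      refine (Metric.mem_closure_iff_infDist_zero (range_nonempty _)).2 ?_
      exact pow_eq_zero_iff two_ne_zero |>.1 (le_antisymm hyδ (sq_nonneg _))
    have hL := H.pos
    have hky : posSupport g y ≤ ⟪k, y⟫ := by
      have hA : Tendsto (fun m => L ^ 2 * posSupport g (y' (φ m)) - δ' (φ m) * ‖k + t m • w‖ ^ 2)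
          atTop (𝓝 (L ^ 2 * posSupport g y)) := by
        simpa using (hhlim.const_mul (L ^ 2)).sub (hδlim.mul (hklim.norm.pow 2))
      have hB : Tendsto (fun m => L ^ 2 * ⟪k + t m • w, y' (φ m)⟫) atTop (𝓝 (L ^ 2 * ⟪k, y⟫)) :=
        (hklim.inner (𝕜 := ℝ) hylim).const_mul _
      refine le_of_mul_le_mul_left (le_of_tendsto_of_tendsto' hA hB fun m => ?_) (pow_pos hL 2)
      have h1 := hbig m
      have hd := hδ' (φ m)
      have h0 := posSupport_nonneg (g := g) (y' (φ m))
      set ρ := L ^ 2 / (2 * δ' (φ m)) with hρ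
      have hρ0 : 0 < ρ := by positivity
      have hρδ : 2 * ρ * δ' (φ m) = L ^ 2 := by rw [hρ]; field_simp
      have h2 := pow_lt_pow_left₀ h1 (by positivity) two_ne_zero
      rw [norm_add_sq_real, inner_smul_right, norm_smul, hy', Real.norm_of_nonneg hρ0.le] at h2
      have h3 : 2 * ρ * posSupport g (y' (φ m)) ≤
          ‖k + t m • w‖ ^ 2 + 2 * ρ * ⟪k + t m • w, y' (φ m)⟫ := by
        nlinarith [mul_pos hρ0 hd, sq_nonneg (posSupport g (y' (φ m)) + δ' (φ m))]
      have h4 := mul_le_mul_of_nonneg_left h3 hd.le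
      rw [← hρδ]
      linarith
    -- The midpoint satisfies the very constraint that its perturbation violates; subtracting
    -- squares, dividing by `t` and multiplying by `δ` leaves `L² ⟪w, y⟫` in the limit.
    have hwy : 0 ≤ ⟪w, y⟫ := by
      have hA : Tendsto (fun m => 2 * δ' (φ m) * ⟪w, k⟫ + L ^ 2 * ⟪w, y' (φ m)⟫ +
          t m * δ' (φ m) * ‖w‖ ^ 2) atTop (𝓝 (L ^ 2 * ⟪w, y⟫)) := by
        have hwlim : Tendsto (fun m => ⟪w, y' (φ m)⟫) atTop (𝓝 ⟪w, y⟫) :=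
          Tendsto.inner (𝕜 := ℝ) tendsto_const_nhds hylim
        simpa using (((hδlim.const_mul 2).mul_const ⟪w, k⟫).add (hwlim.const_mul (L ^ 2))).add
          ((htlim.mul hδlim).mul_const (‖w‖ ^ 2))
      refine nonneg_of_mul_nonneg_right (ge_of_tendsto' hA fun m => ?_) (pow_pos hL 2)
      have hd := hδ' (φ m)
      have h1 := (norm_midpoint_add_lt hne hk₁ hk₂ (hy' (φ m)) hd (hδ4' _) (hyδ' _)).trans (hbig m)
      set ρ := L ^ 2 / (2 * δ' (φ m)) with hρ
      have hρδ : 2 * ρ * δ' (φ m) = L ^ 2 := by rw [hρ]; field_simp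
      have h2 := pow_lt_pow_left₀ h1 (norm_nonneg _) two_ne_zero
      rw [← hk, add_right_comm k, norm_add_sq_real (k + _) (t m • w), inner_smul_right, norm_smul,
        Real.norm_of_nonneg (ht0 m).le, inner_add_left, inner_smul_left, real_inner_comm w k,
        real_inner_comm w] at h2
      simp only [conj_trivial] at h2
      have h3 : 0 < t m * (2 * ⟪w, k⟫ + 2 * ρ * ⟪w, y' (φ m)⟫ + t m * ‖w‖ ^ 2) := by
        linarith
      have h4 := mul_pos hd (pos_of_mul_pos_right h3 (ht0 m).le)
      rw [← hρδ]
      linarith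
    have e1 := H.inner_le_of_mem_closure hk₁ hy1 hyB
    have e2 := H.inner_le_of_mem_closure hk₂ hy1 hyB
    rw [hk, inner_add_left, inner_smul_left, inner_smul_left] at hky
    simp only [conj_trivial] at hky
    exact (hw y hy1 hyB (by linarith) (by linarith)).not_ge hwy
  · have hρlim : Tendsto (fun m => L ^ 2 / (2 * δ' (φ m))) atTop (𝓝 (L ^ 2 / (2 * δ))) :=
      tendsto_const_nhds.div (hδlim.const_mul 2) (by positivity)
    exact (norm_midpoint_add_lt hne hk₁ hk₂ hy1 hδpos hδ4 hyδ).not_ge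
      (le_of_tendsto_of_tendsto' ((hhlim.add hδlim).add hρlim)
        (hklim.add (hρlim.smul hylim)).norm fun m => (hbig m).le)

lemma uniquePosMaximizers_ballIntersection [FiniteDimensional ℝ V] [Nonempty ι]
    (H : IsContactFamily g a L) : UniquePosMaximizers (ballIntersection g a L) := by
  intro x k₁ hk₁ k₂ hk₂ hmax heq hpos
  by_contra hne
  obtain ⟨p, hp⟩ := H.exists_inner_neg_of_posSupport_eq_zero
  -- Small enough that the push `w` below, midpoint plus `ε • p`, still has `⟪w, x⟫ > 0`.
  set ε := ⟪k₁, x⟫ / (|⟪p, x⟫| + 1) with hε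
  have hε0 : 0 < ε := by positivity
  have hεp : -⟪k₁, x⟫ < ε * ⟪p, x⟫ := by
    have h1 : ε * (|⟪p, x⟫| + 1) = ⟪k₁, x⟫ := div_mul_cancel₀ _ (by positivity)
    nlinarith [neg_abs_le ⟪p, x⟫]
  obtain ⟨t, ht, hmem⟩ := H.exists_midpoint_add_smul_mem
    (w := (1 / 2 : ℝ) • k₁ + (1 / 2 : ℝ) • k₂ + ε • p) hne hk₁ hk₂ (fun y hy hyB h₁ h₂ => by
      have hy0 : posSupport g y = 0 := by
        by_contra h0
        exact hne (H.eq_of_inner_eq_posSupport hy hyB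
          (lt_of_le_of_ne (posSupport_nonneg y) (Ne.symm h0)) hk₁ hk₂ h₁ h₂)
      have h3 := mul_neg_of_pos_of_neg hε0 (hp y (norm_ne_zero_iff.1 (hy ▸ one_ne_zero)) hy0)
      simpa [inner_add_left, inner_smul_left, h₁, h₂, hy0] using h3)
  have h1 := hmax _ hmem
  simp only [inner_add_left, inner_smul_left, conj_trivial, ← heq] at h1
  nlinarith

end IsContactFamily

end Perturbation

/-! ### Gradients of a `C¹` gauge as touching functionals. -/

section GaugeGradient

variable {n : ℕ} {W : Set (EuclideanSpace ℝ (Fin n))}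

lemma convexOn_gauge (hc : Convex ℝ W) (h0 : W ∈ 𝓝 0) : ConvexOn ℝ univ (gauge W) := by
  refine ⟨convex_univ, fun x _ y _ s t hs ht _ => ?_⟩
  refine (gauge_add_le hc (absorbent_nhds_zero h0) _ _).trans_eq ?_
  rw [gauge_smul_of_nonneg hs, gauge_smul_of_nonneg ht]

lemma IsOfClassC1.hasGradientAt_gauge (hC : IsOfClassC1 W) (hc : Convex ℝ W) (h0 : W ∈ 𝓝 0)
    {x : EuclideanSpace ℝ (Fin n)} (hx : gauge W x = 1) :
    HasGradientAt (gauge W) (∇ (gauge W) x) x := by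
  have hopen : IsOpen (gauge W ⁻¹' {0})ᶜ :=
    (isClosed_singleton.preimage (continuous_gauge hc h0)).isOpen_compl
  have hmem : x ∈ (gauge W ⁻¹' {0})ᶜ := by simp [hx]
  exact ((hC.differentiableOn one_ne_zero x hmem).differentiableAt
    (hopen.mem_nhds hmem)).hasGradientAt

lemma inner_gradient_sub_le (hc : Convex ℝ W) (h0 : W ∈ 𝓝 0) {x v : EuclideanSpace ℝ (Fin n)}
    (hx : HasGradientAt (gauge W) v x) (y : EuclideanSpace ℝ (Fin n)) :
    ⟪v, y - x⟫ ≤ gauge W y - gauge W x := by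
  have hconv : ConvexOn ℝ univ (gauge W ∘ AffineMap.lineMap (k := ℝ) x y) := by
    simpa using (convexOn_gauge hc h0).comp_affineMap (AffineMap.lineMap x y)
  have hder : HasDerivAt (gauge W ∘ AffineMap.lineMap (k := ℝ) x y) ⟪v, y - x⟫ (0 : ℝ) := by
    have h1 := hasGradientAt_iff_hasFDerivAt.1 hx
    rw [← AffineMap.lineMap_apply_zero (k := ℝ) x y] at h1
    exact h1.comp_hasDerivAt (0 : ℝ) AffineMap.hasDerivAt_lineMap
  have h2 := hconv.le_slope_of_hasDerivAt (mem_univ _) (mem_univ _) zero_lt_one hder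
  simpa [slope_def_field] using h2

/-- Euler's relation: the subgradient inequality at `0` and at `2x` gives the two bounds. -/
lemma inner_gradient_self (hc : Convex ℝ W) (h0 : W ∈ 𝓝 0) {x v : EuclideanSpace ℝ (Fin n)}
    (hx : HasGradientAt (gauge W) v x) : ⟪v, x⟫ = gauge W x := by
  have h1 := inner_gradient_sub_le hc h0 hx 0
  have h2 := inner_gradient_sub_le hc h0 hx ((2 : ℝ) • x)
  rw [gauge_smul_of_nonneg zero_le_two, two_smul, add_sub_cancel_right] at h2
  rw [gauge_zero, zero_sub, inner_neg_right] at h1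
  simp only [smul_eq_mul] at h2
  linarith

lemma inner_gradient_le (hc : Convex ℝ W) (h0 : W ∈ 𝓝 0) {x v : EuclideanSpace ℝ (Fin n)}
    (hx : HasGradientAt (gauge W) v x) (y : EuclideanSpace ℝ (Fin n)) : ⟪v, y⟫ ≤ gauge W y := by
  have h1 := inner_gradient_sub_le hc h0 hx y
  rw [inner_sub_right, inner_gradient_self hc h0 hx] at h1
  linarith

lemma eq_gradient_of_inner_le {x v w : EuclideanSpace ℝ (Fin n)}
    (hx : HasGradientAt (gauge W) v x) (hw : ∀ y, ⟪w, y⟫ ≤ gauge W y)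
    (hwx : ⟪w, x⟫ = gauge W x) : w = v := by
  have h1 : HasGradientAt (fun y => gauge W y - ⟪w, y⟫) (v - w) x := by
    rw [hasGradientAt_iff_hasFDerivAt] at hx ⊢
    rw [map_sub]
    exact hx.sub (InnerProductSpace.toDual ℝ _ w).hasFDerivAt
  have hmin : IsLocalMin (fun y => gauge W y - ⟪w, y⟫) x :=
    Eventually.of_forall fun y => by
      have := hw y
      simp only [hwx, sub_self]
      linarith
  have h2 := hmin.hasFDerivAt_eq_zero (hasGradientAt_iff_hasFDerivAt.1 h1)
  rw [map_eq_zero_iff _ (InnerProductSpace.toDual ℝ _).injective] at h2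
  exact (sub_eq_zero.1 h2).symm

lemma exists_gauge_le_mul_norm (hc : Convex ℝ W) (h0 : W ∈ 𝓝 0) :
    ∃ C : ℝ, 0 < C ∧ ∀ y, gauge W y ≤ C * ‖y‖ := by
  obtain ⟨C, hC⟩ := hc.lipschitz_gauge h0
  refine ⟨C + 1, by positivity, fun y => ?_⟩
  have h1 := hC.norm_sub_le y 0
  rw [gauge_zero, sub_zero, sub_zero, Real.norm_of_nonneg (gauge_nonneg y)] at h1
  nlinarith [norm_nonneg y]

lemma norm_gradient_le (hc : Convex ℝ W) (h0 : W ∈ 𝓝 0) {C : ℝ} (hC0 : 0 < C)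
    (hC : ∀ y, gauge W y ≤ C * ‖y‖) {x v : EuclideanSpace ℝ (Fin n)}
    (hx : HasGradientAt (gauge W) v x) : ‖v‖ ≤ C := by
  rcases (norm_nonneg v).eq_or_lt with h | h
  · exact h ▸ hC0.le
  · have h1 := (inner_gradient_le hc h0 hx v).trans (hC v)
    rw [real_inner_self_eq_norm_sq, sq] at h1
    exact le_of_mul_le_mul_right h1 h

lemma norm_smul_outerNormal (x : EuclideanSpace ℝ (Fin n)) :
    ‖∇ (gauge W) x‖ • outerNormal W x = ∇ (gauge W) x := by
  rcases eq_or_ne (∇ (gauge W) x) 0 with h | h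
  · simp [h]
  · rw [outerNormal, smul_smul, mul_inv_cancel₀ (norm_ne_zero_iff.2 h), one_smul]

lemma gradient_ne_zero_of_gauge_eq_one (hc : Convex ℝ W) (h0 : W ∈ 𝓝 0)
    {x v : EuclideanSpace ℝ (Fin n)} (hg : HasGradientAt (gauge W) v x) (hx : gauge W x = 1) :
    v ≠ 0 := by
  rintro rfl
  have := inner_gradient_self hc h0 hg
  simp [hx] at this

variable {X : Submodule ℝ (EuclideanSpace ℝ (Fin n))}

lemma inner_orthogonalProjectionOnto_of_mem {v : EuclideanSpace ℝ (Fin n)} (hv : v ∈ X)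
    (x : EuclideanSpace ℝ (Fin n)) : ⟪v, (X.orthogonalProjectionOnto x : _)⟫ = ⟪v, x⟫ := by
  exact X.inner_orthogonalProjectionOnto_eq_of_mem_left ⟨v, hv⟩ x

/-- Gradients at boundary points lie in `X`, so they do not distinguish `x` from its projection. The
gradient at `x` gives `≥`, the one at the normalized projection gives `≤`. -/
lemma gauge_orthogonalProjectionOnto (hC : IsOfClassC1 W) (hc : Convex ℝ W) (h0 : W ∈ 𝓝 0)
    (hX : ∀ x, gauge W x = 1 → ∇ (gauge W) x ∈ X) {x : EuclideanSpace ℝ (Fin n)}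
    (hx : gauge W x = 1) : gauge W (X.orthogonalProjectionOnto x) = 1 := by
  have hge : 1 ≤ gauge W (X.orthogonalProjectionOnto x) := by
    have hg := hC.hasGradientAt_gauge hc h0 hx
    rw [← hx, ← inner_gradient_self hc h0 hg, ← inner_orthogonalProjectionOnto_of_mem (hX x hx)]
    exact inner_gradient_le hc h0 hg _
  set r := gauge W (X.orthogonalProjectionOnto x) with hr
  have hr0 : 0 < r := zero_lt_one.trans_le hge
  refine le_antisymm ?_ hge
  set y : EuclideanSpace ℝ (Fin n) := r⁻¹ • (X.orthogonalProjectionOnto x : _) with hy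
  have hy1 : gauge W y = 1 := by
    rw [hy, gauge_smul_of_nonneg (inv_nonneg.2 hr0.le), ← hr, smul_eq_mul, inv_mul_cancel₀ hr0.ne']
  have hg := hC.hasGradientAt_gauge hc h0 hy1
  have h1 := inner_gradient_self hc h0 hg
  rw [hy1] at h1
  nth_rewrite 2 [hy] at h1
  rw [inner_smul_right, inner_orthogonalProjectionOnto_of_mem (hX y hy1)] at h1
  have h2 := inner_gradient_le hc h0 hg x
  rw [hx] at h2
  have h3 : ⟪∇ (gauge W) y, x⟫ = r := by
    field_simp at h1
    exact h1
  exact h3 ▸ h2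

/-- Gradients are bounded, and any cluster point is a functional below the gauge touching it at `p`.
The `x k` themselves may be unbounded; only their projections matter. -/
lemma tendsto_gradient_gauge (hC : IsOfClassC1 W) (hc : Convex ℝ W) (h0 : W ∈ 𝓝 0)
    (hX : ∀ x, gauge W x = 1 → ∇ (gauge W) x ∈ X) {x z : ℕ → EuclideanSpace ℝ (Fin n)}
    {p : EuclideanSpace ℝ (Fin n)} (hp : gauge W p = 1) (hz : ∀ k, gauge W (z k) = 1)
    (hxp : Tendsto (fun k => (X.orthogonalProjectionOnto (x k) : EuclideanSpace ℝ (Fin n)))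
      atTop (𝓝 p))
    (hzx : Tendsto (fun k => ⟪∇ (gauge W) (z k), x k⟫) atTop (𝓝 1)) :
    Tendsto (fun k => ∇ (gauge W) (z k)) atTop (𝓝 (∇ (gauge W) p)) := by
  obtain ⟨C, hC0, hCle⟩ := exists_gauge_le_mul_norm hc h0
  refine tendsto_of_subseq_tendsto fun ns hns => ?_
  obtain ⟨q, -, φ, hφ, hq⟩ := tendsto_subseq_of_bounded
    (Metric.isBounded_closedBall (x := (0 : EuclideanSpace ℝ (Fin n))) (r := C))
    (x := fun k => ∇ (gauge W) (z (ns k))) (fun k => mem_closedBall_zero_iff.2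
      (norm_gradient_le hc h0 hC0 hCle (hC.hasGradientAt_gauge hc h0 (hz _))))
  refine ⟨φ, ?_⟩
  have hsub : Tendsto (fun k => ns (φ k)) atTop atTop := hns.comp hφ.tendsto_atTop
  have hq1 : q = ∇ (gauge W) p := by
    refine eq_gradient_of_inner_le (hC.hasGradientAt_gauge hc h0 hp) (fun y => ?_) ?_
    · exact le_of_tendsto' (hq.inner (𝕜 := ℝ) tendsto_const_nhds) fun k =>
        inner_gradient_le hc h0 (hC.hasGradientAt_gauge hc h0 (hz _)) y
    · rw [hp]
      refine tendsto_nhds_unique (hq.inner (𝕜 := ℝ) (hxp.comp hsub)) ?_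
      refine (hzx.comp hsub).congr fun k => ?_
      exact (inner_orthogonalProjectionOnto_of_mem (hX _ (hz _)) _).symm
  exact hq1 ▸ hq

end GaugeGradient

/-! ### Necessity of the three conditions. -/

section Necessity

variable {n : ℕ} {W : Set (EuclideanSpace ℝ (Fin n))}
  {X : Submodule ℝ (EuclideanSpace ℝ (Fin n))}

lemma norm_gradient_pos_of_gauge_eq_one (hC : IsOfClassC1 W) (hc : Convex ℝ W) (h0 : W ∈ 𝓝 0)
    {x : EuclideanSpace ℝ (Fin n)} (hx : gauge W x = 1) : 0 < ‖∇ (gauge W) x‖ :=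
  norm_pos_iff.2 (gradient_ne_zero_of_gauge_eq_one hc h0 (hC.hasGradientAt_gauge hc h0 hx) hx)

lemma norm_mul_inner_outerNormal_sub (hC : IsOfClassC1 W) (hc : Convex ℝ W) (h0 : W ∈ 𝓝 0)
    {y : EuclideanSpace ℝ (Fin n)} (hy : gauge W y = 1) (x : EuclideanSpace ℝ (Fin n)) :
    ‖∇ (gauge W) y‖ * ⟪outerNormal W y, x - y⟫ = ⟪∇ (gauge W) y, x⟫ - 1 := by
  rw [← real_inner_smul_left, norm_smul_outerNormal, inner_sub_right,
    inner_gradient_self hc h0 (hC.hasGradientAt_gauge hc h0 hy), hy]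

lemma inner_outerNormal_sub_nonpos (hC : IsOfClassC1 W) (hc : Convex ℝ W) (h0 : W ∈ 𝓝 0)
    {x y : EuclideanSpace ℝ (Fin n)} (hx : gauge W x = 1) (hy : gauge W y = 1) :
    ⟪outerNormal W y, x - y⟫ ≤ 0 := by
  have h1 := norm_mul_inner_outerNormal_sub hC hc h0 hy x
  have h2 := inner_gradient_le hc h0 (hC.hasGradientAt_gauge hc h0 hy) x
  have h3 := norm_gradient_pos_of_gauge_eq_one hC hc h0 hy
  by_contra! h
  nlinarith [mul_pos h3 h]

lemma exists_pos_le_inner_outerNormal_self (hC : IsOfClassC1 W) (hc : Convex ℝ W)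
    (h0 : W ∈ 𝓝 0) : ∃ c : ℝ, 0 < c ∧ ∀ y, gauge W y = 1 → c ≤ ⟪outerNormal W y, y⟫ := by
  obtain ⟨C, hC0, hCle⟩ := exists_gauge_le_mul_norm hc h0
  refine ⟨C⁻¹, inv_pos.2 hC0, fun y hy => ?_⟩
  have hg := hC.hasGradientAt_gauge hc h0 hy
  have h1 := inner_gradient_self hc h0 hg
  rw [outerNormal, inner_smul_left, h1, hy, mul_one]
  exact inv_anti₀ (norm_gradient_pos_of_gauge_eq_one hC hc h0 hy)
    (norm_gradient_le hc h0 hC0 hCle hg)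

lemma tendsto_norm_outerNormal_sub (hC : IsOfClassC1 W) (hc : Convex ℝ W) (h0 : W ∈ 𝓝 0)
    (hX : ∀ x, gauge W x = 1 → ∇ (gauge W) x ∈ X) {x z : ℕ → EuclideanSpace ℝ (Fin n)}
    (hx : ∀ k, gauge W (x k) = 1) (hz : ∀ k, gauge W (z k) = 1)
    (hb : Bornology.IsBounded (range fun k => X.orthogonalProjectionOnto (x k)))
    (hlim : Tendsto (fun k => ⟪outerNormal W (z k), x k - z k⟫) atTop (𝓝 0)) :
    Tendsto (fun k => ‖outerNormal W (z k) - outerNormal W (x k)‖) atTop (𝓝 0) := by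
  obtain ⟨C, hC0, hCle⟩ := exists_gauge_le_mul_norm hc h0
  refine tendsto_of_subseq_tendsto fun ns hns => ?_
  obtain ⟨p, -, φ, hφ, hp⟩ := tendsto_subseq_of_bounded hb
    (x := fun k => X.orthogonalProjectionOnto (x (ns k))) fun k => mem_range_self (ns k)
  refine ⟨φ, ?_⟩
  have hsub : Tendsto (fun k => ns (φ k)) atTop atTop := hns.comp hφ.tendsto_atTop
  have hp' : Tendsto (fun k => (X.orthogonalProjectionOnto (x (ns (φ k))) :
      EuclideanSpace ℝ (Fin n))) atTop (𝓝 (p : EuclideanSpace ℝ (Fin n))) :=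
    (continuous_subtype_val.tendsto p).comp hp
  have hp1 : gauge W (p : EuclideanSpace ℝ (Fin n)) = 1 := by
    refine tendsto_nhds_unique (((continuous_gauge hc h0).tendsto _).comp hp') ?_
    exact tendsto_const_nhds.congr fun k =>
      (gauge_orthogonalProjectionOnto hC hc h0 hX (hx _)).symm
  have hzx : Tendsto (fun k => ⟪∇ (gauge W) (z (ns (φ k))), x (ns (φ k))⟫) atTop (𝓝 1) := by
    have h1 : Tendsto (fun k => ‖∇ (gauge W) (z (ns (φ k)))‖ *
        ⟪outerNormal W (z (ns (φ k))), x (ns (φ k)) - z (ns (φ k))⟫) atTop (𝓝 0) := by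
      refine squeeze_zero_norm (fun k => ?_)
        (by simpa using ((hlim.comp hsub).norm.const_mul C))
      rw [norm_mul, norm_norm]
      exact mul_le_mul_of_nonneg_right
        (norm_gradient_le hc h0 hC0 hCle (hC.hasGradientAt_gauge hc h0 (hz _))) (norm_nonneg _)
    have h2 := h1.add_const 1
    rw [zero_add] at h2
    refine h2.congr fun k => ?_
    rw [norm_mul_inner_outerNormal_sub hC hc h0 (hz _), sub_add_cancel]
  have hxx : Tendsto (fun k => ⟪∇ (gauge W) (x (ns (φ k))), x (ns (φ k))⟫) atTop (𝓝 1) :=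
    tendsto_const_nhds.congr fun k => by
      rw [inner_gradient_self hc h0 (hC.hasGradientAt_gauge hc h0 (hx _)), hx]
  have hne := (norm_gradient_pos_of_gauge_eq_one hC hc h0 hp1).ne'
  have hnormal : ∀ {w : ℕ → EuclideanSpace ℝ (Fin n)}, (∀ k, gauge W (w k) = 1) →
      Tendsto (fun k => ⟪∇ (gauge W) (w k), x (ns (φ k))⟫) atTop (𝓝 1) →
      Tendsto (fun k => outerNormal W (w k)) atTop (𝓝 (outerNormal W p)) := fun hw h => by
    have h1 := tendsto_gradient_gauge hC hc h0 hX hp1 hw hp' h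
    exact (h1.norm.inv₀ hne).smul h1
  simpa using ((hnormal (fun k => hz _) hzx).sub (hnormal (fun k => hx _) hxx)).norm

end Necessity

/-! ### Sufficiency: from the normals to the body. -/

section Sufficiency

variable {n : ℕ} {E : Set (EuclideanSpace ℝ (Fin n))} {N : E → EuclideanSpace ℝ (Fin n)}
  {X : Submodule ℝ (EuclideanSpace ℝ (Fin n))}

/-- The gradients prescribed by the normals `N`, as elements of `X`. -/
noncomputable def prescribedGradient (X : Submodule ℝ (EuclideanSpace ℝ (Fin n)))
    (N : E → EuclideanSpace ℝ (Fin n)) (hNX : ∀ x, N x ∈ X) (x : E) : X :=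
  ⟪N x, (x : EuclideanSpace ℝ (Fin n))⟫⁻¹ • ⟨N x, hNX x⟩

lemma inner_prescribedGradient_proj (hNX : ∀ x, N x ∈ X) (z : E) (x : EuclideanSpace ℝ (Fin n)) :
    ⟪prescribedGradient X N hNX z, X.orthogonalProjectionOnto x⟫ =
      ⟪N z, (z : EuclideanSpace ℝ (Fin n))⟫⁻¹ * ⟪N z, x⟫ := by
  rw [X.inner_orthogonalProjectionOnto_eq_of_mem_left, prescribedGradient, Submodule.coe_smul,
    real_inner_smul_left]

lemma span_prescribedGradient (hNX : ∀ x, N x ∈ X) (hX : X = Submodule.span ℝ (range N))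
    (hpos : ∀ y : E, 0 < ⟪N y, (y : EuclideanSpace ℝ (Fin n))⟫) :
    Submodule.span ℝ (range (prescribedGradient X N hNX)) = ⊤ := by
  refine Submodule.map_injective_of_injective X.injective_subtype ?_
  rw [Submodule.map_span, Submodule.map_top, Submodule.range_subtype]
  refine le_antisymm (Submodule.span_le.2 ?_) ?_
  · rintro _ ⟨v, -, rfl⟩
    exact v.2
  · conv_lhs => rw [hX]
    refine Submodule.span_le.2 ?_
    rintro _ ⟨y, rfl⟩
    have h1 := Submodule.smul_mem _ ⟪N y, (y : EuclideanSpace ℝ (Fin n))⟫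
      (Submodule.subset_span (R := ℝ) (mem_image_of_mem X.subtype
        (mem_range_self (f := prescribedGradient X N hNX) y)))
    rwa [prescribedGradient, Submodule.subtype_apply, Submodule.coe_smul, smul_smul,
      mul_inv_cancel₀ (hpos y).ne', one_smul] at h1

lemma tendsto_inv_smul_sub {F : Type*} [NormedAddCommGroup F] [NormedSpace ℝ F] {u v : ℕ → F}
    {b c : ℕ → ℝ} {r : ℝ} (hr : 0 < r) (hb : ∀ k, r ≤ b k) (hc : ∀ k, r ≤ c k)
    (hv : ∀ k, ‖v k‖ = 1) (huv : Tendsto (fun k => u k - v k) atTop (𝓝 0))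
    (hbc : Tendsto (fun k => b k - c k) atTop (𝓝 0)) :
    Tendsto (fun k => (b k)⁻¹ • u k - (c k)⁻¹ • v k) atTop (𝓝 0) := by
  have hlim : Tendsto (fun k => r⁻¹ * ‖u k - v k‖ + (r * r)⁻¹ * ‖b k - c k‖) atTop (𝓝 0) := by
    simpa using (huv.norm.const_mul r⁻¹).add (hbc.norm.const_mul (r * r)⁻¹)
  refine squeeze_zero_norm (fun k => ?_) hlim
  have hb0 := hr.trans_le (hb k)
  have hc0 := hr.trans_le (hc k)
  have h1 : (b k)⁻¹ • u k - (c k)⁻¹ • v k =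
      (b k)⁻¹ • (u k - v k) + ((b k * c k)⁻¹ * -(b k - c k)) • v k := by
    have : (b k * c k)⁻¹ * -(b k - c k) = (b k)⁻¹ - (c k)⁻¹ := by field_simp; ring
    rw [this]
    module
  rw [h1]
  refine (norm_add_le _ _).trans ?_
  rw [norm_smul, norm_smul, norm_mul, norm_neg, hv, mul_one, Real.norm_of_nonneg (by positivity),
    Real.norm_of_nonneg (by positivity : 0 ≤ (b k * c k)⁻¹)]
  have := hb k
  have := hc k
  gcongr

lemma isContactFamily_prescribedGradient (hNX : ∀ x, N x ∈ X)
    (hX : X = Submodule.span ℝ (range N)) (hN1 : ∀ x, ‖N x‖ = 1)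
    (h₁ : ∀ x y : E, ⟪N y, (x : EuclideanSpace ℝ (Fin n)) - y⟫ ≤ 0)
    (h₂ : ∀ x z : ℕ → E, Bornology.IsBounded
      (range fun k => X.orthogonalProjectionOnto (x k : EuclideanSpace ℝ (Fin n))) →
      Tendsto (fun k => ⟪N (z k), (x k : EuclideanSpace ℝ (Fin n)) - z k⟫) atTop (𝓝 0) →
      Tendsto (fun k => ‖N (z k) - N (x k)‖) atTop (𝓝 0))
    {c : ℝ} (hc0 : 0 < c) (hc : ∀ y : E, c ≤ ⟪N y, (y : EuclideanSpace ℝ (Fin n))⟫) :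
    IsContactFamily (prescribedGradient X N hNX)
      (fun x : E => X.orthogonalProjectionOnto (x : EuclideanSpace ℝ (Fin n))) c⁻¹ where
  pos := inv_pos.2 hc0
  norm_le x := by
    rw [prescribedGradient, norm_smul, Submodule.coe_norm, hN1, mul_one, norm_inv,
      Real.norm_of_nonneg (hc0.le.trans (hc x))]
    exact inv_anti₀ hc0 (hc x)
  inner_le_one z x := by
    have h := h₁ x z
    rw [inner_sub_right] at h
    rw [inner_prescribedGradient_proj, inv_mul_le_one₀ (hc0.trans_le (hc z))]
    linarith
  inner_self x := by
    rw [inner_prescribedGradient_proj, inv_mul_cancel₀ (hc0.trans_le (hc x)).ne']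
  stable x z hb hlim := by
    set b : ℕ → ℝ := fun k => ⟪N (z k), (z k : EuclideanSpace ℝ (Fin n))⟫ with hbdef
    have hbpos : ∀ k, 0 < b k := fun k => hc0.trans_le (hc _)
    have hs : ∀ k, b k * ⟪prescribedGradient X N hNX (z k),
        X.orthogonalProjectionOnto (x k : EuclideanSpace ℝ (Fin n))⟫ =
        ⟪N (z k), (x k : EuclideanSpace ℝ (Fin n))⟫ := fun k => by
      rw [inner_prescribedGradient_proj, mul_inv_cancel_left₀ (hbpos k).ne']
    obtain ⟨M, hM0, hM⟩ := hb.exists_pos_norm_le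
    have hNM : ∀ k, ⟪N (z k), (x k : EuclideanSpace ℝ (Fin n))⟫ ≤ M := fun k => by
      rw [← inner_orthogonalProjectionOnto_of_mem (hNX (z k))]
      refine (real_inner_le_norm _ _).trans ?_
      rw [hN1, one_mul]
      exact hM _ (mem_range_self k)
    have hNlim : Tendsto (fun k => ⟪N (z k), (x k : EuclideanSpace ℝ (Fin n)) - z k⟫) atTop
        (𝓝 0) := by
      have h0 := (tendsto_iff_norm_sub_tendsto_zero.1 hlim).const_mul (2 * M)
      rw [mul_zero] at h0
      refine squeeze_zero_norm' ?_ h0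
      -- The `z k` need not be bounded, but `b k` is eventually at most `2 * M`: its product with an
      -- inner product exceeding `1/2` is at most `M`.
      filter_upwards [hlim.eventually_const_lt (by norm_num : (1 / 2 : ℝ) < 1)] with k hk
      rw [inner_sub_right, ← hs k, ← mul_sub_one, norm_mul, Real.norm_of_nonneg (hbpos k).le]
      refine mul_le_mul_of_nonneg_right ?_ (norm_nonneg _)
      nlinarith [hs k, hNM k, hbpos k]
    have hN : Tendsto (fun k => N (z k) - N (x k)) atTop (𝓝 0) :=
      tendsto_zero_iff_norm_tendsto_zero.2 (h₂ x z hb hNlim)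
    -- The difference equals `⟪N (z k) - N (x k), x k⟫ - ⟪N (z k), x k - z k⟫`.
    have hbc : Tendsto (fun k => b k - ⟪N (x k), (x k : EuclideanSpace ℝ (Fin n))⟫) atTop
        (𝓝 0) := by
      have h3 : Tendsto (fun k => ⟪N (z k) - N (x k), (x k : EuclideanSpace ℝ (Fin n))⟫) atTop
          (𝓝 0) := by
        have h0 := hN.norm.mul_const M
        rw [norm_zero, zero_mul] at h0
        refine squeeze_zero_norm (fun k => ?_) h0
        rw [← inner_orthogonalProjectionOnto_of_mem (X.sub_mem (hNX (z k)) (hNX (x k)))]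
        refine (norm_inner_le_norm _ _).trans ?_
        gcongr
        exact hM _ (mem_range_self k)
      have h4 := h3.sub hNlim
      rw [sub_zero] at h4
      refine h4.congr fun k => ?_
      rw [inner_sub_left, inner_sub_right]
      ring
    have h5 := tendsto_inv_smul_sub hc0 (fun k => hc (z k)) (fun k => hc (x k))
      (fun k => hN1 (x k)) hN hbc
    exact tendsto_subtype_rng.2 h5
  span_eq_top := span_prescribedGradient hNX hX fun y => hc0.trans_le (hc y)

lemma UniquePosMaximizers.image_coe {K : Set X} (hK : UniquePosMaximizers K) :
    UniquePosMaximizers ((↑) '' K : Set (EuclideanSpace ℝ (Fin n))) := by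
  rintro x _ ⟨k₁, hk₁, rfl⟩ _ ⟨k₂, hk₂, rfl⟩ hmax heq hpos
  simp only [forall_mem_image, ← X.inner_orthogonalProjectionOnto_eq_of_mem_left] at hmax heq hpos
  rw [hK _ k₁ hk₁ k₂ hk₂ hmax heq hpos]

/-- The polar is taken in the whole space of a set `K` inside `X`. All gradients at boundary points
are points of `K`, so the normals do not leave `X`. -/
lemma exists_convexBody_of_isContactFamily [Nonempty E] (hNX : ∀ x, N x ∈ X)
    (hX : X = Submodule.span ℝ (range N)) (hN1 : ∀ x, ‖N x‖ = 1)
    (hpos : ∀ y : E, 0 < ⟪N y, (y : EuclideanSpace ℝ (Fin n))⟫) {L : ℝ}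
    (H : IsContactFamily (prescribedGradient X N hNX)
      (fun x : E => X.orthogonalProjectionOnto (x : EuclideanSpace ℝ (Fin n))) L) :
    ∃ W : Set (EuclideanSpace ℝ (Fin n)), IsConvexBody W ∧ IsOfClassC1 W ∧ E ⊆ frontier W ∧
      (0 : EuclideanSpace ℝ (Fin n)) ∈ interior W ∧ (∀ x : E, N x = outerNormal W x) ∧
      X = Submodule.span ℝ (outerNormal W '' frontier W) := by
  set K : Set (EuclideanSpace ℝ (Fin n)) := (↑) '' ballIntersection (prescribedGradient X N hNX)
    (fun x : E => X.orthogonalProjectionOnto (x : EuclideanSpace ℝ (Fin n))) L with hKdef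
  have hK : IsCompact K := H.isCompact_ballIntersection.image continuous_subtype_val
  have h0 : (0 : EuclideanSpace ℝ (Fin n)) ∈ K := ⟨0, H.zero_mem, rfl⟩
  have hu : UniquePosMaximizers K := H.uniquePosMaximizers_ballIntersection.image_coe
  have hW0 := innerPolar_mem_nhds_zero hK.isBounded
  have hint := mem_interior_iff_mem_nhds.2 hW0
  have hgK : ∀ x : E, (prescribedGradient X N hNX x : EuclideanSpace ℝ (Fin n)) ∈ K :=
    fun x => mem_image_of_mem _ (H.gradient_mem x)
  have hgx : ∀ x : E, ⟪(prescribedGradient X N hNX x : EuclideanSpace ℝ (Fin n)), x⟫ = 1 :=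
    fun x => by rw [← X.inner_orthogonalProjectionOnto_eq_of_mem_left]; exact H.inner_self x
  have hmem : ∀ x : E, (x : EuclideanSpace ℝ (Fin n)) ∈ innerPolar K := by
    rintro x _ ⟨k, hk, rfl⟩
    rw [← X.inner_orthogonalProjectionOnto_eq_of_mem_left]
    exact H.inner_point_le_one hk x
  have hgauge : ∀ x : E, gauge (innerPolar K) (x : EuclideanSpace ℝ (Fin n)) = 1 := fun x =>
    le_antisymm (gauge_le_one_of_mem (hmem x))
      (hgx x ▸ inner_le_gauge_innerPolar hK.isBounded (hgK x) x)
  have hfront : E ⊆ frontier (innerPolar K) := fun x hx =>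
    (gauge_eq_one_iff_mem_frontier (convex_innerPolar K) hW0).1 (hgauge ⟨x, hx⟩)
  have hnormal : ∀ x : E, N x = outerNormal (innerPolar K) x := fun x => by
    have hgrad := (hasGradientAt_gauge_innerPolar hK h0 hu (hgK x) ((hgx x).trans (hgauge x).symm)
      (hgauge x ▸ zero_lt_one)).gradient
    have hp := hpos x
    rw [outerNormal, hgrad, prescribedGradient, Submodule.coe_smul, norm_smul, hN1, mul_one,
      norm_inv, Real.norm_of_nonneg hp.le, inv_inv, smul_smul, mul_inv_cancel₀ hp.ne', one_smul]
  refine ⟨innerPolar K, ⟨isClosed_innerPolar K, convex_innerPolar K, ⟨0, hint⟩⟩,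
    contDiffOn_gauge_innerPolar hK h0 hu, hfront, hint, hnormal, le_antisymm ?_ ?_⟩
  · conv_lhs => rw [hX]
    refine Submodule.span_mono ?_
    rintro _ ⟨x, rfl⟩
    exact ⟨x, hfront x.2, (hnormal x).symm⟩
  · refine Submodule.span_le.2 ?_
    rintro _ ⟨x, hx, rfl⟩
    have hx1 := (gauge_eq_one_iff_mem_frontier (convex_innerPolar K) hW0).2 hx
    obtain ⟨_, ⟨k, hk, rfl⟩, hkx⟩ := exists_inner_eq_gauge_innerPolar hK h0 x
    have hgrad := (hasGradientAt_gauge_innerPolar hK h0 hu (mem_image_of_mem _ hk) hkx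
      (hx1 ▸ zero_lt_one)).gradient
    rw [outerNormal, hgrad]
    exact X.smul_mem _ k.2

end Sufficiency

theorem mainTheorem8 (n : ℕ) (E : Set (EuclideanSpace ℝ (Fin n)))
    (N : E → Metric.sphere (0 : EuclideanSpace ℝ (Fin n)) 1) (hN : Continuous N)
    (X : Submodule ℝ (EuclideanSpace ℝ (Fin n)))
    (hX : X = Submodule.span ℝ
      (Set.range fun x : E => (N x : EuclideanSpace ℝ (Fin n)))) :
    (∃ W : Set (EuclideanSpace ℝ (Fin n)),
        IsConvexBody W ∧ IsOfClassC1 W ∧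
        E ⊆ frontier W ∧
        (0 : EuclideanSpace ℝ (Fin n)) ∈ interior W ∧
        (∀ x : E, (N x : EuclideanSpace ℝ (Fin n)) = outerNormal W x) ∧
        X = Submodule.span ℝ (outerNormal W '' frontier W)) ↔
      ((∀ x y : E, inner ℝ (N y : EuclideanSpace ℝ (Fin n))
          ((x : EuclideanSpace ℝ (Fin n)) - y) ≤ 0) ∧
        (∀ x z : ℕ → E,
          Bornology.IsBounded
            (Set.range fun k => X.orthogonalProjectionOnto (x k : EuclideanSpace ℝ (Fin n))) →
          Filter.Tendsto
            (fun k => inner ℝ (N (z k) : EuclideanSpace ℝ (Fin n))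
              ((x k : EuclideanSpace ℝ (Fin n)) - z k))
            Filter.atTop (nhds 0) →
          Filter.Tendsto
            (fun k => ‖(N (z k) : EuclideanSpace ℝ (Fin n)) - N (x k)‖)
            Filter.atTop (nhds 0)) ∧
        (0 : EReal) < ⨅ y : E,
          ((inner ℝ (N y : EuclideanSpace ℝ (Fin n))
            (y : EuclideanSpace ℝ (Fin n)) : ℝ) : EReal)) := by
  constructor
  · rintro ⟨W, hW, hC, hE, hint, hNW, hXW⟩
    have h0 := mem_interior_iff_mem_nhds.1 hint
    have hg : ∀ x : E, gauge W (x : EuclideanSpace ℝ (Fin n)) = 1 := fun x =>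
      (gauge_eq_one_iff_mem_frontier hW.convex h0).2 (hE x.2)
    have hgrad : ∀ x, gauge W x = 1 → ∇ (gauge W) x ∈ X := fun x hx => by
      rw [← norm_smul_outerNormal, hXW]
      exact Submodule.smul_mem _ _ (Submodule.subset_span
        (mem_image_of_mem _ ((gauge_eq_one_iff_mem_frontier hW.convex h0).1 hx)))
    simp only [hNW]
    refine ⟨fun x y => inner_outerNormal_sub_nonpos hC hW.convex h0 (hg x) (hg y),
      fun x z hb hlim => tendsto_norm_outerNormal_sub hC hW.convex h0 hgrad (fun k => hg _)
        (fun k => hg _) hb hlim, ?_⟩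
    obtain ⟨c, hc0, hc⟩ := exists_pos_le_inner_outerNormal_self hC hW.convex h0
    exact (EReal.coe_pos.2 hc0).trans_le (le_iInf fun y => EReal.coe_le_coe_iff.2 (hc _ (hg y)))
  · rintro ⟨h₁, h₂, h₃⟩
    rcases isEmpty_or_nonempty E with hE | hE
    -- For empty `E` the span is zero, and the whole space works: its gauge vanishes and its
    -- frontier is empty.
    · refine ⟨univ, ⟨isClosed_univ, convex_univ, by simp⟩, ?_, ?_, by simp, hE.elim, ?_⟩
      · have : gauge (univ : Set (EuclideanSpace ℝ (Fin n))) = 0 := by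
          ext x
          refine le_antisymm (le_of_forall_pos_le_add fun ε hε => ?_) (gauge_nonneg x)
          rw [Pi.zero_apply, zero_add]
          exact gauge_le_of_mem hε.le (by rw [smul_set_univ₀ hε.ne']; trivial)
        rw [IsOfClassC1, this]
        exact contDiffOn_const
      · exact fun x hx => (hE.false ⟨x, hx⟩).elim
      · rw [hX, frontier_univ, image_empty, range_eq_empty]
    · obtain ⟨c, hc0, hc⟩ := EReal.lt_iff_exists_real_btwn.1 h₃
      have hc0' : 0 < c := EReal.coe_pos.1 hc0
      have hcle : ∀ y : E, c ≤ ⟪(N y : EuclideanSpace ℝ (Fin n)), (y : EuclideanSpace ℝ (Fin n))⟫ :=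
        fun y => EReal.coe_le_coe_iff.1 (hc.le.trans (iInf_le _ y))
      have hNX : ∀ x, (N x : EuclideanSpace ℝ (Fin n)) ∈ X := fun x => by
        rw [hX]
        exact Submodule.subset_span (mem_range_self x)
      have hN1 : ∀ x, ‖(N x : EuclideanSpace ℝ (Fin n))‖ = 1 := fun x => norm_eq_of_mem_sphere _
      exact exists_convexBody_of_isContactFamily hNX hX hN1 (fun y => hc0'.trans_le (hcle y))
        (isContactFamily_prescribedGradient hNX hX hN1 h₁ h₂ hc0' hcle)
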